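/- Let $X$ and $Y$ be real Banach spaces with duals $X^*$, $Y^*$, and identify $(X\times Y)^*$ with $X^*\times Y^*$. Let $G:X\rightrightarrows Y$ be a multifunction whose graph $\operatorname{gph}G=\{(x,y)\mid y\in G(x)\}$ is convex and closed. Let $\varphi:X\times Y\to[-\infty,+\infty]$ be proper (that is, $\operatorname{dom}\varphi=\{\varphi<+\infty\}\neq\emptyset$ and $\varphi>-\infty$ everywhere), convex and closed (that is, its epigraph $\{(z,\alpha)\in (X\times Y)\times\mathbb R\mid \varphi(z)\le\alpha\}$ is convex and closed). Let $$\mu(x)=\inf\{\varphi(x,y)\mid y\in G(x)\},\qquad \inf\emptyset=+\infty,$$ be the optimal value function, and suppose that $\mu(\bar x)$ is finite at a given $\bar x\in X$. Assume that at least one of the following holds: (i) $\mathbb R_+(\operatorname{dom}\varphi-\operatorname{gph}G)=\{t a\mid t\ge 0,\ a\in \operatorname{dom}\varphi-\operatorname{gph}G\}$ is a closed linear subspace of $X\times Y$; (ii) $(0,0)\in\operatorname{int}(\operatorname{dom}\varphi-\operatorname{gph}G)$. Then for every $\varepsilon\ge 0$ $$\begin{aligned}\partial_\varepsilon\mu(\bar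 x)&=\bigcap_{\eta>0}\ \bigcap_{y\in M_\eta(\bar x)}\ \bigcup_{(\gamma_1,\gamma_2)\in\Gamma(\eta+\varepsilon)}\big\{x^*\in X^*\mid (x^*,0)\in\partial_{\gamma_1}\varphi(\bar x,y)+N_{\gamma_2}((\bar x,y);\operatorname{gph}G)\big\}\\&=\bigcap_{\eta>0}\ \bigcup_{y\in Y}\ \bigcup_{(\gamma_1,\gamma_2)\in\Gamma(\eta+\varepsilon)}\big\{x^*\in X^*\mid (x^*,0)\in\partial_{\gamma_1}\varphi(\bar x,y)+N_{\gamma_2}((\bar x,y);\operatorname{gph}G)\big\}.\end{aligned}$$ Here $M_\eta(\bar x)=\{y\in G(\bar x)\mid\varphi(\bar x,y)\le\mu(\bar x)+\eta\}$ and $\Gamma(s)=\{(\gamma_1,\gamma_2)\mid\gamma_1\ge0,\ \gamma_2\ge0,\ \gamma_1+\gamma_2=s\}$. For a function $f$ on a Banach space $Z$ with values in $[-\infty,+\infty]$, a point $\bar z\in Z$ and $\varepsilon\ge0$, $\partial_\varepsilon f(\bar z)=\{z^*\in Z^*\mid\langle z^*,z-\bar z\rangle\le f(z)-f(\bar z)+\varepsilon\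 \ \forall z\in Z\}$ if $\bar z\in\operatorname{dom}f$, and $\partial_\varepsilon f(\bar z)=\emptyset$ otherwise. For $C\subset Z$, $N_\varepsilon(\bar z;C)=\{z^*\in Z^*\mid\langle z^*,z-\bar z\rangle\le\varepsilon\ \ \forall z\in C\}$ if $\bar z\in C$, and $N_\varepsilon(\bar z;C)=\emptyset$ otherwise. -/

import Mathlib

open scoped Pointwise

namespace EpsSubdiff

/-- The effective domain `{x | f x < +∞}` of an extended real-valued function. -/
def dom {X : Type*} (f : X → EReal) : Set X := {x | f x < ⊤}

/-- The epigraph `{(x, α) ∈ X × ℝ | f x ≤ α}`. -/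
def epi {X : Type*} (f : X → EReal) : Set (X × ℝ) := {p | f p.1 ≤ (p.2 : EReal)}

/-- `f` is proper: its domain is nonempty and it never takes the value `-∞`. -/
def ProperFun {X : Type*} (f : X → EReal) : Prop := (dom f).Nonempty ∧ ∀ x, ⊥ < f x

/-- `f` is a convex function: its epigraph is convex. -/
def ConvexFun {X : Type*} [AddCommGroup X] [Module ℝ X] (f : X → EReal) : Prop :=
  Convex ℝ (epi f)

/-- `f` is a closed function: its epigraph is closed. -/
def ClosedFun {X : Type*} [TopologicalSpace X] (f : X → EReal) : Prop :=
  IsClosed (epi f)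

/-- The graph of a multifunction `G : X ⇉ Y`. -/
def gph {X Y : Type*} (G : X → Set Y) : Set (X × Y) := {p | p.2 ∈ G p.1}

/-- `G` is a convex multifunction: its graph is convex. -/
def ConvexMultifun {X Y : Type*} [AddCommGroup X] [Module ℝ X] [AddCommGroup Y] [Module ℝ Y]
    (G : X → Set Y) : Prop := Convex ℝ (gph G)

/-- The cone `ℝ₊(A) = {t a | t ≥ 0, a ∈ A}` generated by `A`. -/
def coneGen {X : Type*} [AddCommGroup X] [Module ℝ X] (A : Set X) : Set X :=
  {z | ∃ t : ℝ, 0 ≤ t ∧ ∃ a ∈ A, z = t • a}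

section Normed

variable {X : Type*} [NormedAddCommGroup X] [NormedSpace ℝ X]

/-- The `ε`-subdifferential of `f` at `x₀`; it is empty when `x₀` is outside the domain of `f`. -/
def epsSubdiff (ε : ℝ) (f : X → EReal) (x₀ : X) : Set (X →L[ℝ] ℝ) :=
  {x' | x₀ ∈ dom f ∧ ∀ x, ((x' (x - x₀) : ℝ) : EReal) ≤ f x - f x₀ + (ε : EReal)}

/-- The set of `ε`-normal directions to `C` at `x₀`; it is empty when `x₀` is outside `C`. -/
def epsNormal (ε : ℝ) (x₀ : X) (C : Set X) : Set (X →L[ℝ] ℝ) :=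
  {x' | x₀ ∈ C ∧ ∀ x ∈ C, x' (x - x₀) ≤ ε}

end Normed

/-- The optimal value function `μ(x) = inf {φ(x, y) | y ∈ G(x)}`, where `inf ∅ = +∞`. -/
noncomputable def optValue {X Y : Type*} (φ : X × Y → EReal) (G : X → Set Y) (x : X) : EReal :=
  ⨅ y ∈ G x, φ (x, y)

/-- The approximate solution set `M_η(x) = {y ∈ G(x) | φ(x, y) ≤ μ(x) + η}`. -/
def approxSol {X Y : Type*} (φ : X × Y → EReal) (G : X → Set Y) (η : ℝ) (x : X) : Set Y :=
  {y | y ∈ G x ∧ φ (x, y) ≤ optValue φ G x + (η : EReal)}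

/-- The set `Γ(s)` of pairs of nonnegative reals with sum `s`. -/
def splitPairs (s : ℝ) : Set (ℝ × ℝ) := {γ | 0 ≤ γ.1 ∧ 0 ≤ γ.2 ∧ γ.1 + γ.2 = s}

/-- All `x'` in the dual of `X` such that the functional `(x', 0) : (u, v) ↦ x' u` belongs to
`∂_{γ₁} φ(x, y) + N_{γ₂}((x, y); gph G)`, for a pair `γ = (γ₁, γ₂)`. -/
def sumSlice {X Y : Type*} [NormedAddCommGroup X] [NormedSpace ℝ X]
    [NormedAddCommGroup Y] [NormedSpace ℝ Y]
    (φ : X × Y → EReal) (G : X → Set Y) (γ : ℝ × ℝ) (x : X) (y : Y) : Set (X →L[ℝ] ℝ) :=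
  {x' | x'.coprod (0 : Y →L[ℝ] ℝ) ∈ epsSubdiff γ.1 φ (x, y) + epsNormal γ.2 (x, y) (gph G)}

end EpsSubdiff

open EpsSubdiff

/-! A functional `x'` is an `ε`-subgradient of `μ` at `x₀` iff `x' (u - x₀) ≤ φ (u, v) - μ x₀ + ε`
on `gph G`. At an `η`-solution `y`, `φ (x₀, y) ≤ μ x₀ + η`, so `(x', 0)` is an `(η + ε)`-subgradient
at `(x₀, y)` of `φ` plus the indicator of `gph G`; the sum rule
`exists_mem_epsSubdiff_add_epsNormal` splits it. Conversely, adding the two inequalities of a slice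
and using `μ x₀ ≤ φ (x₀, y)` on the graph gives the subgradient inequality for `μ` with error `η +
ε`, and `η → 0`. One `y` for each `η` suffices, which gives both formulas.

The sum rule is an Attouch–Brezis argument. Tilted by `z'`, `φ` becomes a function `f ≥ 0` on `C`.
Baire's theorem and an open mapping argument for convex sets bound `v ↦ inf {f z | z - c = v, c ∈
C}` above near the origin of `S`. Hahn–Banach then supports it at the origin by a functional `w`,
and `z' = (z' + w) + (-w)` is the splitting. -/

namespace EpsSubdiff

open Filter Topology

/-! ### Open mapping argument for closed bounded convex sets, and Baire category -/

section Interior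

variable {W Z : Type*} [NormedAddCommGroup W] [NormedSpace ℝ W] [CompleteSpace W]
  [NormedAddCommGroup Z] [NormedSpace ℝ Z]

/-- A closed bounded convex set contains every convex series `∑ 2⁻⁽ᵏ⁺¹⁾ eₖ` of its elements. -/
theorem exists_hasSum_dyadic_mem {E : Set W} (hconv : Convex ℝ E) (hclosed : IsClosed E)
    (hbdd : Bornology.IsBounded E) {e : ℕ → W} (he : ∀ n, e n ∈ E) :
    ∃ w ∈ E, HasSum (fun n => (1 / 2 : ℝ) ^ (n + 1) • e n) w := by
  obtain ⟨R, hR⟩ := hbdd.exists_norm_le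
  have hgeo : Summable (fun n : ℕ => (1 / 2 : ℝ) ^ (n + 1) * R) := by
    refine Summable.mul_right _ ?_
    exact (summable_nat_add_iff 1).2 summable_geometric_two
  have hsum : Summable (fun n => (1 / 2 : ℝ) ^ (n + 1) • e n) := by
    refine Summable.of_norm_bounded hgeo fun n => ?_
    rw [norm_smul, Real.norm_of_nonneg (by positivity)]
    exact mul_le_mul_of_nonneg_left (hR _ (he n)) (by positivity)
  -- Placing the leftover weight `2⁻ⁿ` on a point of `E` makes each partial sum a true convex
  -- combination, so `0 ∈ E` is not needed.
  have hpartial : ∀ n, ∀ a ∈ E,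
      ∑ k ∈ Finset.range n, (1 / 2 : ℝ) ^ (k + 1) • e k + (1 / 2 : ℝ) ^ n • a ∈ E := by
    intro n
    induction n with
    | zero => intro a ha; simpa using ha
    | succ n ih =>
      intro a ha
      have hmid : (1 / 2 : ℝ) • e n + (1 / 2 : ℝ) • a ∈ E :=
        hconv (he n) ha (by norm_num) (by norm_num) (by norm_num)
      have := ih _ hmid
      rw [smul_add, smul_smul, smul_smul, ← pow_succ, ← add_assoc] at this
      rwa [Finset.sum_range_succ]
  refine ⟨_, ?_, hsum.hasSum⟩
  have h0 : Tendsto (fun n : ℕ => (1 / 2 : ℝ) ^ n • e 0) atTop (𝓝 ((0 : ℝ) • e 0)) :=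
    (tendsto_pow_atTop_nhds_zero_of_lt_one (by norm_num) (by norm_num)).smul_const _
  have hlim := hsum.hasSum.tendsto_sum_nat.add h0
  rw [zero_smul, add_zero] at hlim
  exact hclosed.mem_of_tendsto hlim (Eventually.of_forall fun n => hpartial n _ (he 0))

/-- If the closure of the image of a closed bounded convex set contains a ball of the subspace `S`,
then the image itself contains the ball of half the radius. -/
theorem mem_image_of_ball_subset_closure (T : W →L[ℝ] Z) {E : Set W} (hconv : Convex ℝ E)
    (hclosed : IsClosed E) (hbdd : Bornology.IsBounded E) (S : Submodule ℝ Z)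
    (hTS : ∀ e ∈ E, T e ∈ S) {δ : ℝ} (hδ : 0 < δ)
    (hball : ∀ v ∈ S, ‖v‖ < δ → v ∈ closure (T '' E)) {v : Z} (hvS : v ∈ S)
    (hv : ‖v‖ < δ / 2) : v ∈ T '' E := by
  -- The map `x ↦ 2x - T e` preserves the half ball of `S`: `2x` lies in the full ball, hence within
  -- `δ / 2` of some `T e`. Iterating it reads off the dyadic digits of `v`.
  have hstep : ∀ x : {x : Z // x ∈ S ∧ ‖x‖ < δ / 2}, ∃ e ∈ E, ‖(2 : ℝ) • x.1 - T e‖ < δ / 2 := by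
    rintro ⟨x, hxS, hx⟩
    have hcl := hball ((2 : ℝ) • x) (S.smul_mem _ hxS) (by
      rw [norm_smul, Real.norm_of_nonneg (by norm_num)]; linarith)
    obtain ⟨_, ⟨e, he, rfl⟩, hd⟩ := Metric.mem_closure_iff.1 hcl (δ / 2) (by positivity)
    exact ⟨e, he, by rwa [← dist_eq_norm]⟩
  choose e heE he using hstep
  let next : {x : Z // x ∈ S ∧ ‖x‖ < δ / 2} → {x : Z // x ∈ S ∧ ‖x‖ < δ / 2} := fun x =>
    ⟨(2 : ℝ) • x.1 - T (e x), S.sub_mem (S.smul_mem _ x.2.1) (hTS _ (heE x)), he x⟩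
  let x : ℕ → {x : Z // x ∈ S ∧ ‖x‖ < δ / 2} := fun n => next^[n] ⟨v, hvS, hv⟩
  have hx : ∀ n, (x (n + 1)).1 = (2 : ℝ) • (x n).1 - T (e (x n)) := fun n => by
    simp only [x, Function.iterate_succ_apply']; rfl
  obtain ⟨w, hwE, hw⟩ := exists_hasSum_dyadic_mem hconv hclosed hbdd (fun n => heE (x n))
  refine ⟨w, hwE, ?_⟩
  have hpart : ∀ n, T (∑ k ∈ Finset.range n, (1 / 2 : ℝ) ^ (k + 1) • e (x k)) =
      v - (1 / 2 : ℝ) ^ n • (x n).1 := by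
    intro n
    induction n with
    | zero => simp [x]
    | succ n ih =>
      rw [Finset.sum_range_succ, map_add, ih, map_smul, hx, smul_sub, smul_smul,
        show (1 / 2 : ℝ) ^ (n + 1) * 2 = (1 / 2) ^ n by rw [pow_succ]; ring]
      abel
  have h1 := (T.continuous.tendsto w).comp hw.tendsto_sum_nat
  have h2 : Tendsto (fun n => (1 / 2 : ℝ) ^ n • (x n).1) atTop (𝓝 0) := by
    refine squeeze_zero_norm (a := fun n => (1 / 2 : ℝ) ^ n * (δ / 2)) (fun n => ?_) ?_
    · rw [norm_smul, Real.norm_of_nonneg (by positivity)]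
      exact mul_le_mul_of_nonneg_left (x n).2.2.le (by positivity)
    · simpa using (tendsto_pow_atTop_nhds_zero_of_lt_one (r := (1 / 2 : ℝ))
        (by norm_num) (by norm_num)).mul_const (δ / 2)
  have h3 := h2.const_sub v
  rw [sub_zero] at h3
  exact tendsto_nhds_unique (h1.congr hpart) h3

end Interior

/-- Baire category for an increasing sequence of convex sets: if their union is absorbing, then the
closure of one of them is a neighbourhood of the origin. -/
theorem exists_closure_mem_nhds_zero {V : Type*} [NormedAddCommGroup V] [NormedSpace ℝ V]
    [CompleteSpace V] {A : ℕ → Set V} (hconv : ∀ n, Convex ℝ (A n)) (hmono : Monotone A)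
    (hzero : ∃ n, (0 : V) ∈ A n)
    (habs : ∀ v : V, ∃ t : ℝ, 0 ≤ t ∧ ∃ n, ∃ a ∈ A n, v = t • a) :
    ∃ n, closure (A n) ∈ 𝓝 (0 : V) := by
  obtain ⟨n₀, hn₀⟩ := hzero
  -- One index serves as dilation and as stage: for large `m`, convexity and `0 ∈ A m` allow
  -- shrinking `a` by `t / (m + 1) ≤ 1`.
  have habs' : ∀ v : V, ∃ n : ℕ, ((n : ℝ) + 1)⁻¹ • v ∈ A n := by
    intro v
    obtain ⟨t, ht, n, a, ha, rfl⟩ := habs v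
    obtain ⟨k, hk⟩ := exists_nat_ge t
    refine ⟨max n₀ (max n k), ?_⟩
    set m := max n₀ (max n k)
    have hkm : (k : ℝ) ≤ m := by exact_mod_cast (le_max_right n k).trans (le_max_right _ _)
    rw [smul_smul]
    refine (hconv m).smul_mem_of_zero_mem (hmono (le_max_left _ _) hn₀)
      (hmono ((le_max_left n k).trans (le_max_right _ _)) ha) ⟨by positivity, ?_⟩
    rw [inv_mul_le_iff₀ (by positivity)]
    linarith
  have hcover : ⋃ n : ℕ, (fun v : V => ((n : ℝ) + 1)⁻¹ • v) ⁻¹' closure (A n) = Set.univ := by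
    refine Set.eq_univ_of_forall fun v => ?_
    obtain ⟨n, hn⟩ := habs' v
    exact Set.mem_iUnion.2 ⟨n, subset_closure hn⟩
  obtain ⟨n, v, hv⟩ := nonempty_interior_of_iUnion_of_closed
    (fun n => isClosed_closure.preimage (continuous_const_smul _)) hcover
  obtain ⟨m, hm⟩ := habs' (-v)
  have hn1 : (0 : ℝ) < (n : ℝ) + 1 := by positivity
  have hm1 : (0 : ℝ) < (m : ℝ) + 1 := by positivity
  set p := max n m
  refine ⟨p, ?_⟩
  -- Points `v + u` and `-v`, suitably scaled, average to a multiple of `u`.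
  have hs : (0 : ℝ) < (n + 1) + (m + 1) := by positivity
  have hnear : ∀ᶠ u in 𝓝 (0 : V), v + ((n : ℝ) + 1 + (m + 1)) • u ∈
      (fun v : V => ((n : ℝ) + 1)⁻¹ • v) ⁻¹' closure (A n) := by
    have hc : Tendsto (fun u : V => v + ((n : ℝ) + 1 + (m + 1)) • u) (𝓝 0) (𝓝 v) := by
      have : Continuous fun u : V => v + ((n : ℝ) + 1 + (m + 1)) • u := by fun_prop
      simpa using this.tendsto 0
    exact hc (mem_interior_iff_mem_nhds.1 hv)
  filter_upwards [hnear] with u hu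
  have h1 := closure_mono (hmono (le_max_left n m)) hu
  have h2 := closure_mono (hmono (le_max_right n m)) (subset_closure hm)
  have h3 := (hconv p).closure h1 h2 (a := ((n : ℝ) + 1) / ((n + 1) + (m + 1)))
    (b := ((m : ℝ) + 1) / ((n + 1) + (m + 1))) (by positivity) (by positivity)
    (by field_simp)
  convert h3 using 1
  simp only [smul_smul]
  rw [show ((n : ℝ) + 1) / ((n + 1) + (m + 1)) * ((n : ℝ) + 1)⁻¹ = ((n : ℝ) + 1 + (m + 1))⁻¹ by
      field_simp, show ((m : ℝ) + 1) / ((n + 1) + (m + 1)) * ((m : ℝ) + 1)⁻¹ =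
      ((n : ℝ) + 1 + (m + 1))⁻¹ by field_simp, smul_add, smul_smul, inv_mul_cancel₀ hs.ne', one_smul,
    smul_neg]
  abel

/-! ### Attouch–Brezis separation -/

section Sandwich

variable {Z : Type*} [NormedAddCommGroup Z] [NormedSpace ℝ Z] [CompleteSpace Z]

/-- If `E` is a closed convex epigraph, `C` a closed convex set and the differences of their points
generate the closed subspace `S`, then the value function `v ↦ inf {α | (c + v, α) ∈ E, c ∈ C}` is
bounded above on a ball of `S`. -/
theorem exists_uniform_bound_of_coneGen_eq {E : Set (Z × ℝ)} (hE : Convex ℝ E)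
    (hEclosed : IsClosed E) (hup : ∀ z α β, (z, α) ∈ E → α ≤ β → (z, β) ∈ E)
    {C : Set Z} (hC : Convex ℝ C) (hCclosed : IsClosed C)
    (hne : ∃ z ∈ C, ∃ α, (z, α) ∈ E) {S : Submodule ℝ Z} (hS : IsClosed (S : Set Z))
    (hcone : coneGen (Prod.fst '' E - C) = (S : Set Z)) :
    ∃ δ > 0, ∃ M : ℝ, 0 ≤ M ∧ ∀ v ∈ S, ‖v‖ < δ → ∃ z c, (z, M) ∈ E ∧ c ∈ C ∧ v = z - c := by
  have : CompleteSpace S := hS.completeSpace_coe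
  -- Truncating both height and norm makes each `K n` bounded, as the dyadic series requires, while
  -- the `K n` still exhaust all pairs.
  let K : ℕ → Set (Z × Z) := fun n =>
    {p | (p.1, (n : ℝ)) ∈ E ∧ p.2 ∈ C ∧ p ∈ Metric.closedBall (0 : Z × Z) n}
  let T : Z × Z →L[ℝ] Z := ContinuousLinearMap.fst ℝ Z Z - ContinuousLinearMap.snd ℝ Z Z
  have hT : ∀ p, T p = p.1 - p.2 := fun p => rfl
  have hKconv : ∀ n, Convex ℝ (K n) := by
    intro n p hp q hq a b ha hb hab
    refine ⟨?_, hC hp.2.1 hq.2.1 ha hb hab, convex_closedBall _ _ hp.2.2 hq.2.2 ha hb hab⟩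
    have := hE hp.1 hq.1 ha hb hab
    simpa [← add_mul, hab] using this
  have hKclosed : ∀ n, IsClosed (K n) := fun n =>
    (hEclosed.preimage (f := fun p : Z × Z => (p.1, (n : ℝ))) (by fun_prop)).inter
      ((hCclosed.preimage continuous_snd).inter Metric.isClosed_closedBall)
  have hKbdd : ∀ n, Bornology.IsBounded (K n) := fun n =>
    Metric.isBounded_closedBall.subset fun p hp => hp.2.2
  have hKmono : Monotone K := by
    intro m n hmn p hp
    have hmn' : (m : ℝ) ≤ n := by exact_mod_cast hmn
    exact ⟨hup _ _ _ hp.1 hmn', hp.2.1, Metric.closedBall_subset_closedBall hmn' hp.2.2⟩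
  have hKmem : ∀ z c α, (z, α) ∈ E → c ∈ C → ∃ n, (z, c) ∈ K n := by
    intro z c α hz hc
    obtain ⟨n, hn⟩ := exists_nat_ge (max α ‖((z, c) : Z × Z)‖)
    exact ⟨n, hup _ _ _ hz ((le_max_left _ _).trans hn), hc,
      mem_closedBall_zero_iff.2 ((le_max_right _ _).trans hn)⟩
  have hTS : ∀ n, ∀ p ∈ K n, T p ∈ S := by
    intro n p hp
    rw [← SetLike.mem_coe, ← hcone]
    exact ⟨1, zero_le_one, _, Set.sub_mem_sub ⟨_, hp.1, rfl⟩ hp.2.1, (one_smul _ _).symm⟩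
  obtain ⟨n, hn⟩ := exists_closure_mem_nhds_zero (V := S)
    (A := fun n => (Subtype.val : S → Z) ⁻¹' (T '' K n))
    (fun n => ((hKconv n).linear_image T.toLinearMap).linear_preimage S.subtype)
    (fun m n hmn => Set.preimage_mono (Set.image_mono (hKmono hmn)))
    (by
      obtain ⟨z, hzC, α, hz⟩ := hne
      obtain ⟨n, hn⟩ := hKmem z z α hz hzC
      exact ⟨n, _, hn, by simp [hT]⟩)
    (by
      rintro ⟨v, hv⟩
      rw [← SetLike.mem_coe, ← hcone] at hv
      obtain ⟨t, ht, _, ⟨_, ⟨⟨z, α⟩, hz, rfl⟩, c, hc, rfl⟩, rfl⟩ := hv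
      obtain ⟨n, hn⟩ := hKmem z c α hz hc
      exact ⟨t, ht, n, ⟨_, hTS n _ hn⟩, ⟨_, hn, rfl⟩, rfl⟩)
  obtain ⟨δ, hδ, hball⟩ := Metric.mem_nhds_iff.1 hn
  refine ⟨δ / 2, by positivity, n, n.cast_nonneg, fun v hv hvδ => ?_⟩
  obtain ⟨p, hp, rfl⟩ := mem_image_of_ball_subset_closure T (hKconv n) (hKclosed n) (hKbdd n) S
    (hTS n) hδ (fun u hu huδ => by
      have h1 : (⟨u, hu⟩ : S) ∈ closure ((Subtype.val : S → Z) ⁻¹' (T '' K n)) :=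
        hball (mem_ball_zero_iff.2 huδ)
      exact closure_mono (Set.image_preimage_subset _ _)
        (image_closure_subset_closure_image continuous_subtype_val ⟨_, h1, rfl⟩)) hv hvδ
  exact ⟨p.1, p.2, hp.1, hp.2.1, rfl⟩

/-- Attouch–Brezis separation: a closed convex function that is nonnegative on the closed convex set
`C` satisfies `w (z - c) ≤ f z` for some continuous linear `w` and all `c ∈ C`. -/
theorem exists_clm_sub_le_of_nonneg {E : Set (Z × ℝ)} (hE : Convex ℝ E)
    (hEclosed : IsClosed E) (hup : ∀ z α β, (z, α) ∈ E → α ≤ β → (z, β) ∈ E)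
    {C : Set Z} (hC : Convex ℝ C) (hCclosed : IsClosed C)
    (hne : ∃ z ∈ C, ∃ α, (z, α) ∈ E) {S : Submodule ℝ Z} (hS : IsClosed (S : Set Z))
    (hcone : coneGen (Prod.fst '' E - C) = (S : Set Z))
    (hnonneg : ∀ z ∈ C, ∀ α, (z, α) ∈ E → 0 ≤ α) :
    ∃ w : Z →L[ℝ] ℝ, ∀ z α, (z, α) ∈ E → ∀ c ∈ C, w (z - c) ≤ α := by
  obtain ⟨δ, hδ, M, hM, hbound⟩ :=
    exists_uniform_bound_of_coneGen_eq hE hEclosed hup hC hCclosed hne hS hcone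
  -- `U` lies between the strict epigraph and the epigraph of the value function on `S`.
  let U : Set (S × ℝ) := {p | ∃ z c, (z, p.2) ∈ E ∧ c ∈ C ∧ p.1.1 = z - c}
  have hU : Convex ℝ U := by
    rintro p ⟨z, c, hz, hc, hp⟩ q ⟨z', c', hz', hc', hq⟩ a b ha hb hab
    refine ⟨a • z + b • z', a • c + b • c', hE hz hz' ha hb hab, hC hc hc' ha hb hab, ?_⟩
    simp only [Prod.fst_add, Prod.smul_fst, Submodule.coe_add, Submodule.coe_smul, hp, hq, smul_sub]
    abel
  have hint : ((0 : S), M + 1) ∈ interior U := by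
    rw [mem_interior]
    refine ⟨Metric.ball 0 δ ×ˢ Set.Ioi M, ?_, Metric.isOpen_ball.prod isOpen_Ioi,
      Metric.mem_ball_self hδ, Set.mem_Ioi.2 (by linarith)⟩
    rintro ⟨v, α⟩ ⟨hv, hα⟩
    obtain ⟨z, c, hz, hc, hvz⟩ := hbound v v.2 (mem_ball_zero_iff.1 hv)
    exact ⟨z, c, hup _ _ _ hz (le_of_lt hα), hc, hvz⟩
  have h0 : ((0 : S), (0 : ℝ)) ∉ interior U := by
    intro h
    have hc : Tendsto (fun t : ℝ => ((0 : S), t)) (𝓝 0) (𝓝 ((0 : S), (0 : ℝ))) :=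
      Continuous.tendsto (by fun_prop) 0
    have hnear := hc (mem_interior_iff_mem_nhds.1 h)
    obtain ⟨r, hr, hball⟩ := Metric.mem_nhds_iff.1 hnear
    obtain ⟨z, c, hz, hc, hzc⟩ := hball (show -(r / 2) ∈ Metric.ball (0 : ℝ) r by
      rw [mem_ball_zero_iff, norm_neg, Real.norm_of_nonneg (by positivity)]; linarith)
    have hzc' : z = c := (sub_eq_zero.1 hzc.symm)
    have := hnonneg z (hzc' ▸ hc) _ hz
    simp only at this
    linarith
  obtain ⟨f, hf⟩ := geometric_hahn_banach_open_point hU.interior isOpen_interior h0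
  have hf0 : f ((0 : S), (0 : ℝ)) = 0 := map_zero f
  have hfU : ∀ p ∈ U, f p ≤ 0 := by
    intro p hp
    have hp' : p ∈ closure (interior U) :=
      (hU.closure_interior_eq_closure_of_nonempty_interior ⟨_, hint⟩).symm ▸ subset_closure hp
    exact closure_minimal (fun q hq => (hf0 ▸ (hf q hq).le : f q ≤ 0))
      (isClosed_le f.continuous continuous_const) hp'
  have hsplit : ∀ v α, f (v, α) = f (v, 0) + α * f (0, 1) := by
    intro v α
    rw [← smul_eq_mul, ← map_smul, ← map_add]
    simp
  -- The separating hyperplane is not vertical, because an interior point of `U` lies directly above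
  -- the origin.
  have hβ : f (0, 1) < 0 := by
    have := hf _ hint
    rw [hsplit, hf0, zero_add] at this
    by_contra! hcon
    nlinarith [mul_nonneg (by linarith : 0 ≤ M + 1) hcon]
  -- Normalizing the vertical coefficient to `-1` gives a functional on `S` only; Hahn–Banach
  -- extends it to `Z`.
  obtain ⟨w, hw, -⟩ := exists_extension_norm_eq S
    ((-f (0, 1))⁻¹ • f.comp (ContinuousLinearMap.inl ℝ S ℝ))
  refine ⟨w, fun z α hz c hc => ?_⟩
  have hmem : z - c ∈ S := by
    rw [← SetLike.mem_coe, ← hcone]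
    exact ⟨1, zero_le_one, _, Set.sub_mem_sub ⟨_, hz, rfl⟩ hc, (one_smul _ _).symm⟩
  have h1 := hw ⟨z - c, hmem⟩
  have h2 := hfU (⟨z - c, hmem⟩, α) ⟨z, c, hz, hc, rfl⟩
  rw [hsplit] at h2
  simp only [smul_apply, ContinuousLinearMap.comp_apply,
    ContinuousLinearMap.inl_apply, smul_eq_mul] at h1
  rw [h1, inv_mul_le_iff₀ (by linarith)]
  linarith

end Sandwich

/-- The cone generated by a neighbourhood of the origin is the whole space. -/
theorem coneGen_eq_univ_of_zero_mem_interior {Z : Type*} [NormedAddCommGroup Z] [NormedSpace ℝ Z]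
    {A : Set Z} (hA : (0 : Z) ∈ interior A) : coneGen A = Set.univ := by
  refine Set.eq_univ_of_forall fun v => ?_
  have hc : Tendsto (fun t : ℝ => t • v) (𝓝[>] 0) (𝓝 0) := by
    have : Continuous fun t : ℝ => t • v := by fun_prop
    simpa using (this.tendsto 0).mono_left nhdsWithin_le_nhds
  obtain ⟨t, htA, ht⟩ :=
    ((hc.eventually (mem_interior_iff_mem_nhds.1 hA)).and self_mem_nhdsWithin).exists
  have ht : 0 < t := ht
  exact ⟨t⁻¹, by positivity, _, htA, by rw [smul_smul, inv_mul_cancel₀ ht.ne', one_smul]⟩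

/-! ### Epigraphs and the sum rule for `ε`-subgradients -/

section SumRule

variable {Z : Type*}

theorem epi_upward {φ : Z → EReal} {z : Z} {α β : ℝ} (h : (z, α) ∈ epi φ) (hαβ : α ≤ β) :
    (z, β) ∈ epi φ :=
  le_trans (show φ z ≤ (α : EReal) from h) (by exact_mod_cast hαβ)

theorem exists_mem_epi {φ : Z → EReal} {z : Z} (hz : z ∈ dom φ) : ∃ α : ℝ, (z, α) ∈ epi φ := by
  obtain ⟨α, hα, -⟩ := EReal.lt_iff_exists_real_btwn.1 (show φ z < ⊤ from hz)
  exact ⟨α, hα.le⟩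

theorem fst_image_epi (φ : Z → EReal) : Prod.fst '' epi φ = dom φ := by
  ext z
  constructor
  · rintro ⟨⟨z, α⟩, h, rfl⟩
    exact lt_of_le_of_lt (show φ z ≤ (α : EReal) from h) (EReal.coe_lt_top α)
  · intro h
    obtain ⟨α, hα⟩ := exists_mem_epi h
    exact ⟨_, hα, rfl⟩

variable [NormedAddCommGroup Z] [NormedSpace ℝ Z]

/-- At a point where `f` has the real value `a`, membership in the `ε`-subdifferential only involves
the points of the epigraph. -/
theorem mem_epsSubdiff_iff {f : Z → EReal} {z₀ : Z} {a : ℝ} (ha : f z₀ = a) {ε : ℝ}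
    {z' : Z →L[ℝ] ℝ} :
    z' ∈ epsSubdiff ε f z₀ ↔ ∀ z α, (z, α) ∈ epi f → z' (z - z₀) ≤ α - a + ε := by
  have key : ∀ z, (((z' (z - z₀) : ℝ) : EReal) ≤ f z - f z₀ + (ε : EReal)) ↔
      ((z' (z - z₀) + a - ε : ℝ) : EReal) ≤ f z := by
    intro z
    rw [ha]
    induction f z with
    | bot => simp only [EReal.bot_sub, EReal.bot_add, le_bot_iff, EReal.coe_ne_bot]
    | top => simp
    | coe r =>
      norm_cast
      constructor <;> intro h <;> linarith
  constructor
  · rintro ⟨-, h⟩ z α hz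
    have := ((key z).1 (h z)).trans (show f z ≤ (α : EReal) from hz)
    norm_cast at this
    linarith
  · intro h
    refine ⟨show f z₀ < ⊤ by rw [ha]; exact EReal.coe_lt_top a, fun z => (key z).2 ?_⟩
    refine EReal.le_of_forall_lt_iff_le.1 fun α hα => ?_
    have := h z α hα.le
    norm_cast
    linarith

variable [CompleteSpace Z]

/-- The sum rule for `ε`-subgradients of `φ + δ_C` under the Attouch–Brezis condition. -/
theorem exists_mem_epsSubdiff_add_epsNormal {φ : Z → EReal} (hφ : ConvexFun φ)
    (hφclosed : ClosedFun φ) {C : Set Z} (hC : Convex ℝ C) (hCclosed : IsClosed C)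
    {S : Submodule ℝ Z} (hS : IsClosed (S : Set Z)) (hcone : coneGen (dom φ - C) = (S : Set Z))
    {z₀ : Z} (hz₀ : z₀ ∈ C) {a : ℝ} (ha : φ z₀ = a) {s : ℝ} {z' : Z →L[ℝ] ℝ}
    (hz' : ∀ z ∈ C, ∀ α, (z, α) ∈ epi φ → z' (z - z₀) ≤ α - a + s) :
    ∃ γ ∈ splitPairs s, z' ∈ epsSubdiff γ.1 φ z₀ + epsNormal γ.2 z₀ C := by
  have hz₀E : (z₀, a) ∈ epi φ := ha.le
  -- The tilted epigraph, that of `φ - z' (· - z₀) - a + s`.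
  let τ : Z × ℝ → Z × ℝ := fun p => (p.1, p.2 + z' (p.1 - z₀) + a - s)
  have hτc : Continuous τ := by fun_prop
  have hτmem : ∀ z α, (z, α) ∈ epi φ → (z, α - z' (z - z₀) - a + s) ∈ τ ⁻¹' epi φ := by
    intro z α h
    have : τ (z, α - z' (z - z₀) - a + s) = (z, α) := by simp only [τ]; congr 1; ring
    rwa [Set.mem_preimage, this]
  have hconv : Convex ℝ (τ ⁻¹' epi φ) := by
    rintro p hp q hq b c hb hc hbc
    have h := hφ hp hq hb hc hbc
    have heq : τ (b • p + c • q) = b • τ p + c • τ q := by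
      refine Prod.ext rfl ?_
      simp only [τ, Prod.fst_add, Prod.snd_add, Prod.smul_fst, Prod.smul_snd, map_sub, map_add,
        map_smul, smul_eq_mul]
      linear_combination (-(a - s) + z' z₀) * hbc
    rwa [Set.mem_preimage, heq]
  have hfst : Prod.fst '' (τ ⁻¹' epi φ) = dom φ := by
    rw [← fst_image_epi]
    ext z
    constructor
    · rintro ⟨p, hp, rfl⟩
      exact ⟨_, hp, rfl⟩
    · rintro ⟨⟨z, α⟩, hp, rfl⟩
      exact ⟨_, hτmem _ _ hp, rfl⟩
  obtain ⟨w, hw⟩ := exists_clm_sub_le_of_nonneg hconv (IsClosed.preimage hτc hφclosed)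
    (fun z α β h hαβ => epi_upward h (by linarith)) hC hCclosed
    ⟨z₀, hz₀, _, hτmem _ _ hz₀E⟩ hS (hfst ▸ hcone)
    (fun z hz α h => by
      have := hz' z hz _ h
      linarith)
  have hw' : ∀ z α, (z, α) ∈ epi φ → ∀ c ∈ C, w (z - c) ≤ α - z' (z - z₀) - a + s :=
    fun z α h c hc => hw z _ (hτmem z α h) c hc
  -- The infimum over `C` of `w (· - z₀)` determines the splitting of `s`.
  have hbdd : BddAbove ((fun c => w (z₀ - c)) '' C) := by
    refine ⟨s, ?_⟩
    rintro _ ⟨c, hc, rfl⟩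
    simpa using hw' z₀ a hz₀E c hc
  set r := sSup ((fun c => w (z₀ - c)) '' C)
  have hle : ∀ c ∈ C, w (z₀ - c) ≤ r := fun c hc => le_csSup hbdd ⟨c, hc, rfl⟩
  have hr : ∀ z α, (z, α) ∈ epi φ → w (z - z₀) + r ≤ α - z' (z - z₀) - a + s := by
    intro z α h
    rw [add_comm, ← le_sub_iff_add_le]
    refine csSup_le ⟨_, z₀, hz₀, rfl⟩ ?_
    rintro _ ⟨c, hc, rfl⟩
    have := hw' z α h c hc
    simp only [map_sub] at this ⊢
    linarith
  have hrs := hr z₀ a hz₀E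
  simp only [sub_self, map_zero] at hrs
  have hr0 := hle z₀ hz₀
  simp only [sub_self, map_zero] at hr0
  -- `r` is the least error for which `-w` is normal to `C` at `z₀`; what remains of `s` goes to `z'
  -- + w`. Testing at `z₀` gives `0 ≤ r ≤ s`.
  refine ⟨(s - r, r), ⟨by simp only; linarith, hr0, by simp⟩, z' + w, ?_, -w, ⟨hz₀, ?_⟩, by simp⟩
  · rw [mem_epsSubdiff_iff ha]
    intro z α h
    have := hr z α h
    simp only [add_apply]
    linarith
  · intro c hc
    have := hle c hc
    simp only [map_sub, neg_apply] at this ⊢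
    linarith

end SumRule

theorem optValue_le {X Y : Type*} {φ : X × Y → EReal} {G : X → Set Y} {x : X} {y : Y}
    (hy : y ∈ G x) : optValue φ G x ≤ φ (x, y) :=
  iInf₂_le y hy

theorem approxSol_nonempty {X Y : Type*} {φ : X × Y → EReal} {G : X → Set Y} {x : X} {m : ℝ}
    (hm : optValue φ G x = m) {η : ℝ} (hη : 0 < η) : (approxSol φ G η x).Nonempty := by
  have h : optValue φ G x < ((m + η : ℝ) : EReal) := by
    rw [hm]; exact_mod_cast lt_add_of_pos_right m hη
  obtain ⟨y, hy⟩ := iInf_lt_iff.1 h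
  obtain ⟨hyG, hy⟩ := iInf_lt_iff.1 hy
  refine ⟨y, hyG, ?_⟩
  rw [hm]
  exact_mod_cast hy.le

/-! ### The two inclusions for the optimal value function -/

section Main

variable {X Y : Type*} [NormedAddCommGroup X] [NormedSpace ℝ X]
  [NormedAddCommGroup Y] [NormedSpace ℝ Y]

/-- If the slices at arbitrarily good accuracy all contain `x'`, then `x'` is an `ε`-subgradient of
the optimal value function. -/
theorem mem_epsSubdiff_optValue {φ : X × Y → EReal} (hφ : ∀ z, ⊥ < φ z) {G : X → Set Y} {x₀ : X}
    {m : ℝ} (hm : optValue φ G x₀ = m) {ε : ℝ} {x' : X →L[ℝ] ℝ}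
    (h : ∀ η > 0, ∃ y, ∃ γ ∈ splitPairs (η + ε), x' ∈ sumSlice φ G γ x₀ y) :
    x' ∈ epsSubdiff ε (optValue φ G) x₀ := by
  rw [mem_epsSubdiff_iff hm]
  intro x α hx
  refine le_of_forall_pos_le_add fun η hη => ?_
  -- Half of `η` is spent on the slice, the other half on choosing `y` nearly optimal at `x`.
  obtain ⟨y₀, γ, ⟨-, -, hγ⟩, u, hu, v, ⟨hv₀, hv⟩, huv⟩ := h (η / 2) (by positivity)
  obtain ⟨a, ha⟩ : ∃ a : ℝ, φ (x₀, y₀) = a :=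
    ⟨_, (EReal.coe_toReal (ne_of_lt hu.1) (hφ _).ne').symm⟩
  have hma : m ≤ a := by
    have := optValue_le (φ := φ) hv₀
    rw [hm, ha] at this
    exact_mod_cast this
  rw [mem_epsSubdiff_iff ha] at hu
  have hlt : optValue φ G x < ((α + η / 2 : ℝ) : EReal) :=
    lt_of_le_of_lt (show optValue φ G x ≤ (α : EReal) from hx)
      (by exact_mod_cast lt_add_of_pos_right α (by positivity))
  obtain ⟨y, hy⟩ := iInf_lt_iff.1 hlt
  obtain ⟨hyG, hy⟩ := iInf_lt_iff.1 hy
  have h1 := hu (x, y) _ hy.le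
  have h2 := hv (x, y) hyG
  have h3 : u ((x, y) - (x₀, y₀)) + v ((x, y) - (x₀, y₀)) = x' (x - x₀) := by
    rw [← add_apply]
    exact (DFunLike.congr_fun huv _).trans (by simp)
  linarith

/-- An `ε`-subgradient of the optimal value function belongs to a slice at every approximate
solution. -/
theorem exists_mem_sumSlice [CompleteSpace X] [CompleteSpace Y]
    {G : X → Set Y} (hGconv : ConvexMultifun G) (hGclosed : IsClosed (gph G))
    {φ : X × Y → EReal} (hφ : ∀ z, ⊥ < φ z) (hφclosed : ClosedFun φ) (hφconv : ConvexFun φ)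
    {x₀ : X} {m : ℝ} (hm : optValue φ G x₀ = m) {S : Submodule ℝ (X × Y)}
    (hS : IsClosed (S : Set (X × Y))) (hcone : coneGen (dom φ - gph G) = (S : Set (X × Y)))
    {ε : ℝ} {x' : X →L[ℝ] ℝ} (hx' : x' ∈ epsSubdiff ε (optValue φ G) x₀) {η : ℝ} {y : Y}
    (hy : y ∈ approxSol φ G η x₀) :
    ∃ γ ∈ splitPairs (η + ε), x' ∈ sumSlice φ G γ x₀ y := by
  obtain ⟨hyG, hyη⟩ := hy
  rw [hm, ← EReal.coe_add] at hyη
  obtain ⟨a, ha⟩ : ∃ a : ℝ, φ (x₀, y) = a :=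
    ⟨_, (EReal.coe_toReal (ne_of_lt (hyη.trans_lt (EReal.coe_lt_top _))) (hφ _).ne').symm⟩
  rw [ha] at hyη
  have hyη : a ≤ m + η := by exact_mod_cast hyη
  -- The total error is `s = η + ε`: replacing `m` by `a ≤ m + η` costs `η`.
  refine exists_mem_epsSubdiff_add_epsNormal hφconv hφclosed hGconv hGclosed hS hcone hyG ha ?_
  rintro ⟨u, v⟩ hv α hα
  have h := (mem_epsSubdiff_iff hm).1 hx' u α
    ((optValue_le (show v ∈ G u from hv)).trans hα : optValue φ G u ≤ (α : EReal))
  have : (x'.coprod (0 : Y →L[ℝ] ℝ)) ((u, v) - (x₀, y)) = x' (u - x₀) := by simp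
  linarith

end Main

end EpsSubdiff

theorem mainTheorem2 {X Y : Type*}
    [NormedAddCommGroup X] [NormedSpace ℝ X] [CompleteSpace X]
    [NormedAddCommGroup Y] [NormedSpace ℝ Y] [CompleteSpace Y]
    (G : X → Set Y) (hGconv : ConvexMultifun G) (hGclosed : IsClosed (gph G))
    (φ : X × Y → EReal) (hφproper : ProperFun φ) (hφclosed : ClosedFun φ)
    (hφconv : ConvexFun φ)
    (x₀ : X) (hμbot : optValue φ G x₀ ≠ ⊥) (hμtop : optValue φ G x₀ ≠ ⊤)
    (hreg : (∃ S : Submodule ℝ (X × Y), IsClosed (S : Set (X × Y)) ∧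
          coneGen (dom φ - gph G) = (S : Set (X × Y))) ∨
        ((0, 0) : X × Y) ∈ interior (dom φ - gph G))
    (ε : ℝ) (hε : 0 ≤ ε) :
    epsSubdiff ε (optValue φ G) x₀ =
        (⋂ (η : ℝ) (_ : 0 < η), ⋂ y ∈ approxSol φ G η x₀, ⋃ γ ∈ splitPairs (η + ε),
          sumSlice φ G γ x₀ y) ∧
      epsSubdiff ε (optValue φ G) x₀ =
        (⋂ (η : ℝ) (_ : 0 < η), ⋃ y : Y, ⋃ γ ∈ splitPairs (η + ε),
          sumSlice φ G γ x₀ y) := by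
  have hm : optValue φ G x₀ = ((optValue φ G x₀).toReal : EReal) :=
    (EReal.coe_toReal hμtop hμbot).symm
  obtain ⟨S, hS, hcone⟩ : ∃ S : Submodule ℝ (X × Y), IsClosed (S : Set (X × Y)) ∧
      coneGen (dom φ - gph G) = (S : Set (X × Y)) := by
    rcases hreg with h | h
    · exact h
    -- The interior condition is the case in which the generated subspace is the whole space.
    · exact ⟨⊤, isClosed_univ, coneGen_eq_univ_of_zero_mem_interior h⟩
  have hsub : ∀ x' ∈ epsSubdiff ε (optValue φ G) x₀, ∀ η, ∀ y ∈ approxSol φ G η x₀,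
      ∃ γ ∈ splitPairs (η + ε), x' ∈ sumSlice φ G γ x₀ y := fun x' hx' η y hy =>
    exists_mem_sumSlice hGconv hGclosed hφproper.2 hφclosed hφconv hm hS hcone hx' hy
  constructor
  · ext x'
    simp only [Set.mem_iInter, Set.mem_iUnion, exists_prop]
    refine ⟨fun hx' η _ y hy => hsub x' hx' η y hy, fun h => ?_⟩
    refine mem_epsSubdiff_optValue hφproper.2 hm fun η hη => ?_
    -- Finiteness of `μ x₀` and `η > 0` keep the intersection over approximate solutions from being
    -- vacuous.
    obtain ⟨y, hy⟩ := approxSol_nonempty hm hη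
    exact ⟨y, h η hη y hy⟩
  · ext x'
    simp only [Set.mem_iInter, Set.mem_iUnion, exists_prop]
    refine ⟨fun hx' η hη => ?_, mem_epsSubdiff_optValue hφproper.2 hm⟩
    obtain ⟨y, hy⟩ := approxSol_nonempty hm hη
    exact ⟨y, hsub x' hx' η y hy⟩
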